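/- **Conventions.** Let $\mathcal{C}=\{0,1\}^{\mathbb N}$ be the Cantor set. A *Cantor graph* is a closed symmetric set $E\subset\mathcal{C}\times\mathcal{C}$ of bounded vertex degree (there is $d$ with $|\{y:(x,y)\in E\}|\le d$ for all $x$) without loops, except that isolated vertices, and only they, are recorded by their diagonal pair: $(x,x)\in E$ if and only if there is no $y\neq x$ with $(x,y)\in E$. Let $d_E$ be the shortest path distance of $E$ ($\infty$ between different components). We assume that the neighbourhoods of $E$ vary continuously: if $(x,y)\in E$ and $V$ is a neighbourhood of $y$, then every $x'$ sufficiently close to $x$ has some $y'\in V$ with $(x',y')\in E$. $E$ is *proper* if for every integer $r>1$ there is an integer $s_r>1$ such that any two points $x\ne y$ with $d_E(x,y)\le r$ differ in one of their first $s_r$ coordinates. For an integer $D>0$, $E$ is *$D$-doubling* if $|B_{2s}(E,x)|\le D\,|B_s(E,x)|$ for all $x\in\mathcal{C}$ and all integers $s\ge1$, where $B_s(E,x)=\{y: d_E(x,y)\le s\}$. Let $\Gamma$ be a group with a finite symmetric generating set $\Sigma$ and let $\alpha:\Gamma\curvearrowright\mathcal{C}$ be an action by homeomorphisms. Its *graph*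 $E_\alpha$ consists of the pairs $(x,y)$ with $x\neq y$ and $\alpha(\sigma)(x)=y$ for some $\sigma\in\Sigma$, and of the pairs $(x,x)$ with $\alpha(\gamma)(x)=x$ for all $\gamma\in\Gamma$. A *clopen tower* $(S,F)$ of $\alpha$ consists of a clopen set $S\subset\mathcal{C}$ and a finite nonempty set $F\subset\Gamma$ such that the *tiles* $\alpha(F)(s)=\{\alpha(\gamma)(s):\gamma\in F\}$, $s\in S$, are pairwise disjoint for different $s$. For $\varepsilon>0$, a *full clopen $\varepsilon$-castle* of $\alpha$ is a finite family of clopen towers $(S_1,F_1),\dots,(S_m,F_m)$ whose tiles altogether partition $\mathcal{C}$ (tiles of different towers are also disjoint, and every point lies in a tile), such that each tile $H=\alpha(F_j)(s)$, $s\in S_j$, satisfies $|\partial H|/|H|\le\varepsilon$; here $\partial H$ is the set of all $x\in H$ that are adjacent in $E_\alpha$ to some $y\notin H$. The action $\alpha$ is *almost finite* (with respect to $\Sigma$) if it admits a full clopen $\varepsilon$-castle for every $\varepsilon>0$. A Cantor graph $E$ is *almost finite* if $E=E_\alpha$ for an almost finite action $\alpha$ of some group with a finite symmetric generating set. **Theorem.**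 (1) Every $D$-doubling proper Cantor graph $E\subset\mathcal{C}\times\mathcal{C}$ whose neighbourhoods vary continuously is almost finite. (2) Every free action by homeomorphisms on $\mathcal{C}$ of a finitely generated group that has a nilpotent subgroup of finite index is almost finite, with respect to every finite symmetric generating set. -/

import Mathlib

open Topology

namespace CantorGraph

/-- The Cantor set `{0,1}^ℕ`, with the product topology. -/
abbrev Cantor : Type := ℕ → Bool

/-! ### Cantor graphs -/

/-- Cantor graphs: closed symmetric subsets of `Cantor × Cantor` of bounded vertex degree without
loops, except that the isolated vertices are recorded by their diagonal pair. Thus every `x` occurs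
in a pair of `E` (`serial`), and a vertex with a diagonal pair has no other neighbour. -/
structure IsCantorGraph (E : Set (Cantor × Cantor)) : Prop where
  isClosed : IsClosed E
  symm : ∀ x y, (x, y) ∈ E → (y, x) ∈ E
  singleton : ∀ x y, (x, x) ∈ E → (x, y) ∈ E → y = x
  serial : ∀ x, ∃ y, (x, y) ∈ E
  bounded : ∃ d : ℕ, ∀ x, {y | (x, y) ∈ E}.encard ≤ d

/-- The neighbourhoods vary continuously: a neighbour of `x` is approximated by neighbours of
the points close to `x`. -/
def HasContinuousNeighborhoods (E : Set (Cantor × Cantor)) : Prop :=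
  ∀ x y, (x, y) ∈ E → ∀ V ∈ 𝓝 y, ∀ᶠ x' in 𝓝 x, ∃ y' ∈ V, (x', y') ∈ E

/-- The simple graph on the Cantor set underlying `E`: the diagonal pairs are forgotten. -/
def toGraph (E : Set (Cantor × Cantor)) : SimpleGraph Cantor :=
  SimpleGraph.fromRel fun x y => (x, y) ∈ E

/-- Properness: for each `r` some finite number `s` of coordinates separates any two different
points at shortest path distance at most `r` (the distance is `⊤` across components). -/
def IsProper (E : Set (Cantor × Cantor)) : Prop :=
  ∀ r : ℕ, 1 < r → ∃ s : ℕ, 1 < s ∧ ∀ x y : Cantor, x ≠ y →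
    (toGraph E).edist x y ≤ r → ∃ i < s, x i ≠ y i

/-- The ball `B_s(G, x)`: all vertices at distance at most `s` from `x`. -/
def graphBall {V : Type*} (G : SimpleGraph V) (x : V) (s : ℕ) : Set V :=
  {y | G.edist x y ≤ s}

/-- `|B_{2s}(G, x)| ≤ D |B_s(G, x)|` for all vertices `x` and all integers `s ≥ 1`. -/
def IsDoubling {V : Type*} (G : SimpleGraph V) (D : ℕ) : Prop :=
  ∀ (x : V) (s : ℕ), 1 ≤ s →
    (graphBall G x (2 * s)).encard ≤ (D : ℕ∞) * (graphBall G x s).encard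

/-- The inner vertex boundary of `H`. -/
def boundary {V : Type*} (G : SimpleGraph V) (H : Set V) : Set V :=
  {x | x ∈ H ∧ ∃ y, y ∉ H ∧ G.Adj x y}

/-- `|∂H| / |H|`, for a finite nonempty set `H` of vertices. A neighbour of a vertex lies in the
component of that vertex, so for subsets of a component this may be computed in the whole graph. -/
noncomputable def isoperimetricConstant {V : Type*} (G : SimpleGraph V) (H : Set V) : ℝ :=
  ((boundary G H).ncard : ℝ) / (H.ncard : ℝ)

/-! ### Continuous actions on the Cantor set -/

section Action

variable {Γ : Type*} [Group Γ]

/-- `T` is a (finite) symmetric generating system of `Γ`. -/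
def IsSymmGenerating (T : Finset Γ) : Prop :=
  (∀ σ ∈ T, σ⁻¹ ∈ T) ∧ Subgroup.closure (T : Set Γ) = ⊤

/-- The graph of the continuous action `α` with respect to `T`. -/
def actionGraph (T : Finset Γ) (α : Γ →* (Cantor ≃ₜ Cantor)) : Set (Cantor × Cantor) :=
  {p | (p.1 ≠ p.2 ∧ ∃ σ ∈ T, α σ p.1 = p.2) ∨ (p.1 = p.2 ∧ ∀ γ : Γ, α γ p.1 = p.1)}

/-- The tile `α(F)(s)`. -/
def tile (α : Γ →* (Cantor ≃ₜ Cantor)) (F : Finset Γ) (s : Cantor) : Set Cantor :=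
  {y | ∃ γ ∈ F, α γ s = y}

/-- Clopen towers `(S, F)`. -/
structure IsClopenTower (α : Γ →* (Cantor ≃ₜ Cantor)) (S : Set Cantor) (F : Finset Γ) :
    Prop where
  isClopen : IsClopen S
  nonempty : F.Nonempty
  disjoint : ∀ s ∈ S, ∀ t ∈ S, s ≠ t → Disjoint (tile α F s) (tile α F t)

/-- A full clopen `ε`-castle: clopen towers whose tiles altogether partition the Cantor set and
have isoperimetric constant at most `ε` in the graph of the action. -/
structure IsFullClopenCastle (T : Finset Γ) (α : Γ →* (Cantor ≃ₜ Cantor)) (ε : ℝ)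
    {m : ℕ} (S : Fin m → Set Cantor) (F : Fin m → Finset Γ) : Prop where
  tower : ∀ j, IsClopenTower α (S j) (F j)
  disjoint : ∀ i j, i ≠ j → ∀ s ∈ S i, ∀ t ∈ S j, Disjoint (tile α (F i) s) (tile α (F j) t)
  cover : ∀ x, ∃ j, ∃ s ∈ S j, x ∈ tile α (F j) s
  isoperimetric : ∀ j, ∀ s ∈ S j,
    isoperimetricConstant (toGraph (actionGraph T α)) (tile α (F j) s) ≤ ε

/-- Almost finiteness of a continuous action. -/
def IsAlmostFiniteAction (T : Finset Γ) (α : Γ →* (Cantor ≃ₜ Cantor)) : Prop :=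
  ∀ ε : ℝ, 0 < ε → ∃ (m : ℕ) (S : Fin m → Set Cantor) (F : Fin m → Finset Γ),
    IsFullClopenCastle T α ε S F

/-- Freeness: only the identity fixes a point. -/
def IsFreeAction (α : Γ →* (Cantor ≃ₜ Cantor)) : Prop :=
  ∀ (γ : Γ) (x : Cantor), α γ x = x → γ = 1

end Action

/-- `E` is almost finite: it is the graph of an almost finite continuous action of some finitely
generated group. (Such a group is countable, so `Type` is large enough.) -/
def IsAlmostFinite (E : Set (Cantor × Cantor)) : Prop :=
  ∃ (Γ : Type) (_ : Group Γ) (T : Finset Γ) (α : Γ →* (Cantor ≃ₜ Cantor)),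
    IsSymmGenerating T ∧ actionGraph T α = E ∧ IsAlmostFiniteAction T α

end CantorGraph

/-!
Both parts rest on one construction, `isAlmostFiniteAction_of_doubling_frequently`: an action whose
graph is proper and whose balls satisfy `|B_{16 r}| ≤ D |B_r|`, with a fixed `D`, for arbitrarily
large `r`, is almost finite.

Take two such scales, `s` large compared with `D ^ 2 / ε` and `Q` large compared with `s`. Let `X`
be a maximal clopen `2 s`-separated set. By the pigeonhole principle each `x` in `X` has a radius
between `2 s` and `4 s` at which the ball around `x` has few points near its boundary, at most
`|B_{4 s}(x)| / s`. Carve the space by these balls: a point goes to the first point of `X`, in the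
order of a clopen colouring, whose ball contains it. The points with a neighbour in another cell
lie in thin shells around points of `X`, and as the balls of radius `s` around the points of `X` are
disjoint, the shells met by a ball of radius about `4 Q` have at most `(D / s) |B_{16 Q}|` points.
Some cells may have a large boundary of their own, so the cells are not the tiles. A tile is a union
of cells: take a maximal clopen `4 Q`-separated set `Z`, send each point of `X` to a nearby point of
`Z`, and let the tile of `z` be the union of the cells sent to `z`. It contains the ball of radius
`Q` around `z`, so its boundary is at most the fraction `D ^ 2 / s` of it.

All choices are continuous, since properness makes coincidences between points at bounded distance
clopen conditions; hence the tiles are the fibres of a continuous map of bounded displacement, and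
such fibres form a castle (`exists_castle_of_fibers`).

In the first part, a group is found by exchanging the endpoints of the edges with given colours
(`IsCantorGraph.exists_action`). In the second part, properness follows from freeness by
compactness, and the balls have the size of the balls of the group. Virtually nilpotent groups have
polynomial growth (`exists_card_wordBall_le`), hence are doubling at arbitrarily large scales, and
no lower bound for the growth is needed.
-/

namespace CantorGraph

/-! ### Balls, codes and continuous selections -/

open scoped Pointwise

section Engine

variable {Γ : Type*} [Group Γ] {T : Finset Γ} {α : Γ →* (Cantor ≃ₜ Cantor)}

open Classical in
/-- The products of at most `n` elements of `T`. -/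
noncomputable def wordBall (T : Finset Γ) (n : ℕ) : Finset Γ := (insert 1 T) ^ n

lemma mem_wordBall_zero {γ : Γ} : γ ∈ wordBall T 0 ↔ γ = 1 := by
  classical
  rw [wordBall, pow_zero, Finset.mem_one]

lemma mem_wordBall_succ {γ : Γ} {n : ℕ} :
    γ ∈ wordBall T (n + 1) ↔ ∃ σ, (σ = 1 ∨ σ ∈ T) ∧ ∃ δ ∈ wordBall T n, σ * δ = γ := by
  classical
  simp only [wordBall, pow_succ', Finset.mem_mul, Finset.mem_insert]

lemma actionGraph_adj (hT : ∀ σ ∈ T, σ⁻¹ ∈ T) {x y : Cantor} :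
    (toGraph (actionGraph T α)).Adj x y ↔ x ≠ y ∧ ∃ σ ∈ T, α σ x = y := by
  simp only [toGraph, SimpleGraph.fromRel_adj, actionGraph, Set.mem_ofPred_eq]
  constructor
  · rintro ⟨hne, (⟨-, h⟩ | ⟨h, -⟩) | (⟨-, σ, hσ, h⟩ | ⟨h, -⟩)⟩
    · exact ⟨hne, h⟩
    · exact absurd h hne
    · refine ⟨hne, σ⁻¹, hT σ hσ, ?_⟩
      rw [← h, ← Homeomorph.mul_apply, ← map_mul]
      simp
    · exact absurd h.symm hne
  · rintro ⟨hne, h⟩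
    exact ⟨hne, Or.inl (Or.inl ⟨hne, h⟩)⟩

lemma exists_adj_of_edist_le_succ {V : Type*} {G : SimpleGraph V} {x y : V} {n : ℕ}
    (h : G.edist x y ≤ (n + 1 : ℕ)) : ∃ z, G.edist x z ≤ n ∧ (z = y ∨ G.Adj z y) := by
  rw [SimpleGraph.edist_comm] at h
  have hne : G.edist y x ≠ ⊤ := ne_top_of_le_ne_top (ENat.natCast_ne_top _) h
  obtain ⟨p, hp⟩ := SimpleGraph.exists_walk_of_edist_ne_top hne
  rw [← hp, Nat.cast_le] at h
  cases p with
  | nil => exact ⟨_, by simp, Or.inl rfl⟩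
  | @cons _ z _ hadj p =>
    refine ⟨z, ?_, Or.inr hadj.symm⟩
    rw [SimpleGraph.edist_comm]
    refine (SimpleGraph.edist_le p).trans ?_
    simp only [SimpleGraph.Walk.length_cons] at h
    exact_mod_cast (by omega : p.length ≤ n)

lemma edist_le_add {V : Type*} {G : SimpleGraph V} {x y z : V} {m n : ℕ}
    (h : G.edist x y ≤ m) (h' : G.edist y z ≤ n) : G.edist x z ≤ (m + n : ℕ) := by
  push_cast
  exact SimpleGraph.edist_triangle.trans (add_le_add h h')

lemma edist_le_mono {V : Type*} {G : SimpleGraph V} {x y : V} {m n : ℕ}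
    (h : G.edist x y ≤ m) (hmn : m ≤ n) : G.edist x y ≤ n :=
  h.trans (by exact_mod_cast hmn)

lemma edist_le_symm {V : Type*} {G : SimpleGraph V} {x y : V} {m : ℕ∞}
    (h : G.edist x y ≤ m) : G.edist y x ≤ m := by
  rwa [SimpleGraph.edist_comm]

lemma edist_le_iff_exists_wordBall (hT : ∀ σ ∈ T, σ⁻¹ ∈ T) {x y : Cantor} {n : ℕ} :
    (toGraph (actionGraph T α)).edist x y ≤ n ↔ ∃ γ ∈ wordBall T n, α γ x = y := by
  induction n generalizing y with
  | zero => simp [mem_wordBall_zero]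
  | succ n ih =>
    constructor
    · intro h
      obtain ⟨z, hz, hzy⟩ := exists_adj_of_edist_le_succ h
      obtain ⟨γ, hγ, rfl⟩ := ih.1 hz
      rcases hzy with rfl | hzy
      · exact ⟨γ, mem_wordBall_succ.2 ⟨1, Or.inl rfl, γ, hγ, one_mul _⟩, rfl⟩
      · obtain ⟨-, σ, hσ, rfl⟩ := (actionGraph_adj hT).1 hzy
        exact ⟨σ * γ, mem_wordBall_succ.2 ⟨σ, Or.inr hσ, γ, hγ, rfl⟩, by
          rw [map_mul, Homeomorph.mul_apply]⟩
    · rintro ⟨γ, hγ, rfl⟩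
      obtain ⟨σ, hσ, δ, hδ, rfl⟩ := mem_wordBall_succ.1 hγ
      refine edist_le_add (ih.2 ⟨δ, hδ, rfl⟩) ?_
      rw [map_mul, Homeomorph.mul_apply, Nat.cast_one, SimpleGraph.edist_le_one_iff_adj_or_eq]
      by_cases h : α δ x = α σ (α δ x)
      · exact Or.inr h
      · rcases hσ with rfl | hσ
        · simp at h
        · exact Or.inl ((actionGraph_adj hT).2 ⟨h, σ, hσ, rfl⟩)

lemma edist_apply_le (hT : ∀ σ ∈ T, σ⁻¹ ∈ T) {n : ℕ} {γ : Γ} (hγ : γ ∈ wordBall T n)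
    (x : Cantor) : (toGraph (actionGraph T α)).edist x (α γ x) ≤ n :=
  (edist_le_iff_exists_wordBall hT).2 ⟨γ, hγ, rfl⟩

lemma graphBall_eq_image (hT : ∀ σ ∈ T, σ⁻¹ ∈ T) (x : Cantor) (n : ℕ) :
    graphBall (toGraph (actionGraph T α)) x n = (fun γ => α γ x) '' (wordBall T n : Set Γ) := by
  ext y
  simp only [graphBall, Set.mem_ofPred_eq, edist_le_iff_exists_wordBall hT, Set.mem_image,
    Finset.mem_coe]

lemma finite_graphBall (hT : ∀ σ ∈ T, σ⁻¹ ∈ T) (x : Cantor) (n : ℕ) :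
    (graphBall (toGraph (actionGraph T α)) x n).Finite := by
  rw [graphBall_eq_image hT]
  exact (Finset.finite_toSet _).image _

/-- A continuous numbering of the Cantor set that separates points at distance at most `M`. By
compactness it takes finitely many values only; these are the colours of a clopen colouring. -/
structure IsCode (G : SimpleGraph Cantor) (M : ℕ) (κ : Cantor → ℕ) : Prop where
  continuous : Continuous κ
  injective : ∀ x y, G.edist x y ≤ M → κ x = κ y → x = y

lemma IsProper.exists_isCode {E : Set (Cantor × Cantor)} (h : IsProper E) (M : ℕ) :
    ∃ κ, IsCode (toGraph E) M κ := by
  obtain ⟨s, -, hs⟩ := h (max M 2) (by simp)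
  let e : (Fin s → Bool) ≃ Fin _ := Fintype.equivFin (Fin s → Bool)
  refine ⟨fun x => e fun i => x i, ?_, fun x y hxy he => ?_⟩
  · exact (continuous_of_discreteTopology (f := fun v : Fin s → Bool => (e v : ℕ))).comp
      (continuous_pi fun i => continuous_apply _)
  · by_contra hne
    obtain ⟨i, hi, hi'⟩ := hs x y hne (edist_le_mono hxy (le_max_left _ _))
    have := e.injective (Fin.ext he)
    exact hi' (congrFun this ⟨i, hi⟩)

section Clopen

variable {G : SimpleGraph Cantor} {M : ℕ} {κ : Cantor → ℕ}

lemma isClopen_setOf_of_continuous {ι X : Type*} [TopologicalSpace X] [TopologicalSpace ι]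
    [DiscreteTopology ι] {f : X → ι} (hf : Continuous f) (p : ι → Prop) :
    IsClopen {x | p (f x)} :=
  (isClopen_discrete {i | p i}).preimage hf

lemma IsCode.isClopen_eq (hκ : IsCode G M κ) {f g : Cantor → Cantor} (hf : Continuous f)
    (hg : Continuous g) (hfg : ∀ x, G.edist (f x) (g x) ≤ M) : IsClopen {x | f x = g x} := by
  have : {x | f x = g x} = {x | κ (f x) = κ (g x)} := by
    ext x
    exact ⟨fun h => congrArg κ h, fun h => hκ.injective _ _ (hfg x) h⟩
  rw [this]
  exact isClopen_setOf_of_continuous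
    ((hκ.continuous.comp hf).prodMk (hκ.continuous.comp hg)) fun p => p.1 = p.2

end Clopen

variable {M : ℕ} {κ : Cantor → ℕ}

lemma IsCode.isClopen_edist_le (hT : ∀ σ ∈ T, σ⁻¹ ∈ T)
    (hκ : IsCode (toGraph (actionGraph T α)) M κ) {f g : Cantor → Cantor} (hf : Continuous f)
    (hg : Continuous g) {k n : ℕ} (hfg : ∀ x, (toGraph (actionGraph T α)).edist (f x) (g x) ≤ k)
    (hM : n + k ≤ M) : IsClopen {x | (toGraph (actionGraph T α)).edist (f x) (g x) ≤ n} := by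
  have : {x | (toGraph (actionGraph T α)).edist (f x) (g x) ≤ n} =
      ⋃ γ ∈ wordBall T n, {x | α γ (f x) = g x} := by
    ext x
    simp [edist_le_iff_exists_wordBall hT]
  rw [this]
  refine isClopen_biUnion_finset fun γ hγ =>
    hκ.isClopen_eq ((α γ).continuous.comp hf) hg fun x => ?_
  exact edist_le_mono (edist_le_add (edist_le_symm (edist_apply_le hT hγ (f x))) (hfg x)) hM

lemma isClopen_exists_edist_le (hT : ∀ σ ∈ T, σ⁻¹ ∈ T) {Z : Set Cantor} (hZ : IsClopen Z)
    (n : ℕ) : IsClopen {y | ∃ z ∈ Z, (toGraph (actionGraph T α)).edist y z ≤ n} := by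
  have : {y | ∃ z ∈ Z, (toGraph (actionGraph T α)).edist y z ≤ n} =
      ⋃ γ ∈ wordBall T n, (α γ) ⁻¹' Z := by
    ext y
    simp only [Set.mem_ofPred_eq, edist_le_iff_exists_wordBall hT, Set.mem_iUnion,
      Set.mem_preimage, exists_prop]
    constructor
    · rintro ⟨_, hz, γ, hγ, rfl⟩
      exact ⟨γ, hγ, hz⟩
    · rintro ⟨γ, hγ, hz⟩
      exact ⟨_, hz, γ, hγ, rfl⟩
  rw [this]
  exact isClopen_biUnion_finset fun γ _ => hZ.preimage (α γ).continuous

/-- Clopen maximal separated sets: the colour classes of a code are separated, and they are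
added one after the other, each without the points close to the earlier ones. -/
lemma IsCode.exists_clopen_net (hT : ∀ σ ∈ T, σ⁻¹ ∈ T)
    (hκ : IsCode (toGraph (actionGraph T α)) M κ) :
    ∃ X : Set Cantor, IsClopen X ∧
      (∀ x ∈ X, ∀ y ∈ X, (toGraph (actionGraph T α)).edist x y ≤ M → x = y) ∧
      ∀ y, ∃ x ∈ X, (toGraph (actionGraph T α)).edist y x ≤ M := by
  set G := toGraph (actionGraph T α)
  have key : ∀ k : ℕ, ∃ X : Set Cantor, IsClopen X ∧
      (∀ x ∈ X, ∀ y ∈ X, G.edist x y ≤ M → x = y) ∧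
      ∀ y, κ y < k → ∃ x ∈ X, G.edist y x ≤ M := by
    intro k
    induction k with
    | zero => exact ⟨∅, isClopen_empty, by simp, by simp⟩
    | succ k ih =>
      obtain ⟨X, hX, hsep, hcov⟩ := ih
      refine ⟨X ∪ ({y | κ y = k} \ {y | ∃ x ∈ X, G.edist y x ≤ M}), ?_, ?_, ?_⟩
      · exact hX.union ((isClopen_setOf_of_continuous hκ.continuous (· = k)).diff
          (isClopen_exists_edist_le hT hX M))
      · rintro x (hx | ⟨hx, hx'⟩) y (hy | ⟨hy, hy'⟩) hxy
        · exact hsep x hx y hy hxy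
        · exact absurd ⟨x, hx, edist_le_symm hxy⟩ hy'
        · exact absurd ⟨y, hy, hxy⟩ hx'
        · exact hκ.injective _ _ hxy (hx.trans hy.symm)
      · intro y hy
        by_cases h : ∃ x ∈ X, G.edist y x ≤ M
        · obtain ⟨x, hx, hyx⟩ := h
          exact ⟨x, Or.inl hx, hyx⟩
        · have hk : κ y = k := by
            by_contra hne
            exact h (hcov y (by omega))
          exact ⟨y, Or.inr ⟨hk, h⟩, by simp⟩
  obtain ⟨k, hk⟩ := (isCompact_range hκ.continuous).bddAbove
  obtain ⟨X, hX, hsep, hcov⟩ := key (k + 1)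
  exact ⟨X, hX, hsep, fun y => hcov y (Nat.lt_succ_of_le (hk ⟨y, rfl⟩))⟩

/-- Continuous selection: a relation which is clopen along the action and relates every point to
some point at distance at most `n` has a continuous selection, namely the related point with the
least code. -/
lemma IsCode.exists_continuous_selection (hT : ∀ σ ∈ T, σ⁻¹ ∈ T)
    (hκ : IsCode (toGraph (actionGraph T α)) M κ) {n : ℕ} (hn : n + n ≤ M)
    {P : Cantor → Cantor → Prop} (hP : ∀ γ ∈ wordBall T n, IsClopen {y | P y (α γ y)})
    (hex : ∀ y, ∃ x, (toGraph (actionGraph T α)).edist y x ≤ n ∧ P y x) :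
    ∃ f : Cantor → Cantor, Continuous f ∧
      ∀ y, (toGraph (actionGraph T α)).edist y (f y) ≤ n ∧ P y (f y) ∧
        ∀ x, (toGraph (actionGraph T α)).edist y x ≤ n → P y x → κ (f y) ≤ κ x := by
  classical
  set G := toGraph (actionGraph T α)
  have hmin : ∀ y, ∃ x, G.edist y x ≤ n ∧ P y x ∧
      ∀ x', G.edist y x' ≤ n → P y x' → κ x ≤ κ x' := by
    intro y
    have h : ∃ k, ∃ x, G.edist y x ≤ n ∧ P y x ∧ κ x = k := by
      obtain ⟨x, hx, hPx⟩ := hex y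
      exact ⟨_, x, hx, hPx, rfl⟩
    obtain ⟨x, hx, hPx, hk⟩ := Nat.find_spec h
    exact ⟨x, hx, hPx, fun x' hx' hPx' => hk ▸ Nat.find_min' h ⟨x', hx', hPx', rfl⟩⟩
  choose f hfn hfP hfmin using hmin
  refine ⟨f, ?_, fun y => ⟨hfn y, hfP y, hfmin y⟩⟩
  rw [continuous_iff_continuousAt]
  intro y₀
  obtain ⟨γ, hγ, hγf⟩ := (edist_le_iff_exists_wordBall hT).1 (hfn y₀)
  have hA : IsClopen ({y | P y (α γ y)} ∩
      ⋂ δ ∈ wordBall T n, ({y | P y (α δ y)}ᶜ ∪ {y | κ (α γ y) ≤ κ (α δ y)})) := by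
    refine (hP γ hγ).inter (isClopen_biInter_finset fun δ hδ => (hP δ hδ).compl.union ?_)
    exact isClopen_setOf_of_continuous ((hκ.continuous.comp (α γ).continuous).prodMk
      (hκ.continuous.comp (α δ).continuous)) fun p => p.1 ≤ p.2
  have hy₀ : y₀ ∈ {y | P y (α γ y)} ∩
      ⋂ δ ∈ wordBall T n, ({y | P y (α δ y)}ᶜ ∪ {y | κ (α γ y) ≤ κ (α δ y)}) := by
    simp only [Set.mem_inter_iff, Set.mem_ofPred_eq, Set.mem_iInter, Set.mem_union,
      Set.mem_compl_iff]
    refine ⟨by rw [hγf]; exact hfP y₀, fun δ hδ => or_iff_not_imp_left.2 fun h => ?_⟩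
    rw [hγf]
    exact hfmin y₀ _ (edist_apply_le hT hδ y₀) (not_not.1 h)
  have heq : f =ᶠ[𝓝 y₀] fun y => α γ y := by
    filter_upwards [hA.isOpen.mem_nhds hy₀] with y hy
    simp only [Set.mem_inter_iff, Set.mem_ofPred_eq, Set.mem_iInter, Set.mem_union,
      Set.mem_compl_iff] at hy
    obtain ⟨δ, hδ, hδf⟩ := (edist_le_iff_exists_wordBall hT).1 (hfn y)
    refine hκ.injective _ _ (edist_le_mono (edist_le_add (edist_le_symm (hfn y))
      (edist_apply_le hT hγ y)) hn) (le_antisymm ?_ ?_)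
    · exact hfmin y _ (edist_apply_le hT hγ y) hy.1
    · have := (hy.2 δ hδ).resolve_left (not_not.2 (by rw [hδf]; exact hfP y))
      rwa [hδf] at this
  exact ((α γ).continuous.continuousAt).congr heq.symm

/-- The size of a ball depends continuously on the centre: along the action, points at bounded
distance coincide or not according to their codes. -/
lemma IsCode.eventually_ncard_graphBall_eq (hT : ∀ σ ∈ T, σ⁻¹ ∈ T)
    (hκ : IsCode (toGraph (actionGraph T α)) M κ) {n : ℕ} (hn : n + n ≤ M) (x : Cantor) :
    ∀ᶠ y in 𝓝 x, (graphBall (toGraph (actionGraph T α)) y n).ncard =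
      (graphBall (toGraph (actionGraph T α)) x n).ncard := by
  have hcard : ∀ y, (graphBall (toGraph (actionGraph T α)) y n).ncard =
      ((fun γ => κ (α γ y)) '' (wordBall T n : Set Γ)).ncard := by
    intro y
    have hinj : Set.InjOn κ (graphBall (toGraph (actionGraph T α)) y n) := fun a ha b hb hab =>
      hκ.injective _ _ (edist_le_mono (edist_le_add (edist_le_symm ha) hb) hn) hab
    rw [← hinj.ncard_image, graphBall_eq_image hT, Set.image_image]
  have h : ∀ᶠ y in 𝓝 x, ∀ γ ∈ wordBall T n, κ (α γ y) = κ (α γ x) := by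
    rw [Filter.eventually_all_finset]
    intro γ _
    exact (isClopen_setOf_of_continuous (hκ.continuous.comp (α γ).continuous)
      (· = κ (α γ x))).isOpen.mem_nhds rfl
  filter_upwards [h] with y hy
  rw [hcard, hcard, Set.image_congr hy]

/-- If `τ` is a continuous map of bounded displacement whose nonempty fibres have isoperimetric
constant at most `ε`, then the fibres are the tiles of a full clopen `ε`-castle. The towers
collect the values of `τ` according to the set of group elements that describes their fibres. -/
lemma exists_castle_of_fibers (hT : ∀ σ ∈ T, σ⁻¹ ∈ T) (hproper : IsProper (actionGraph T α))
    {ε : ℝ} {n : ℕ} {τ : Cantor → Cantor} (hτ : Continuous τ)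
    (hn : ∀ y, (toGraph (actionGraph T α)).edist y (τ y) ≤ n)
    (hiso : ∀ z, (∃ y, τ y = z) →
      isoperimetricConstant (toGraph (actionGraph T α)) {y | τ y = z} ≤ ε) :
    ∃ (m : ℕ) (S : Fin m → Set Cantor) (F : Fin m → Finset Γ),
      IsFullClopenCastle T α ε S F := by
  classical
  set G := toGraph (actionGraph T α)
  obtain ⟨κ, hκ⟩ := hproper.exists_isCode (n + n)
  let 𝓕 : Finset (Finset Γ) := (wordBall T n).powerset.filter (·.Nonempty)
  let A : Cantor → Finset Γ := fun z => (wordBall T n).filter fun γ => τ (α γ z) = z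
  let e := 𝓕.equivFin
  have hA : ∀ z, tile α (A z) z = {y | τ y = z} := by
    intro z
    ext y
    simp only [tile, A, Finset.mem_filter, Set.mem_ofPred_eq]
    constructor
    · rintro ⟨γ, ⟨-, h⟩, rfl⟩
      exact h
    · rintro rfl
      obtain ⟨γ, hγ, h⟩ := (edist_le_iff_exists_wordBall hT).1 (edist_le_symm (hn y))
      exact ⟨γ, ⟨hγ, by rw [h]⟩, h⟩
  have hdisj : ∀ z z', z ≠ z' → Disjoint (tile α (A z) z) (tile α (A z') z') := by
    intro z z' hne
    rw [hA, hA, Set.disjoint_left]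
    rintro y rfl h
    exact hne h
  have hclopen : ∀ γ ∈ wordBall T n, IsClopen {z | τ (α γ z) = z} := fun γ hγ =>
    hκ.isClopen_eq (hτ.comp (α γ).continuous) continuous_id fun z =>
      edist_le_symm (edist_le_add (edist_apply_le hT hγ z) (hn _))
  refine ⟨_, fun j => {z | A z = (e.symm j : Finset Γ)}, fun j => (e.symm j : Finset Γ), ?_, ?_,
    ?_, ?_⟩
  · intro j
    refine ⟨?_, (Finset.mem_filter.1 (e.symm j).2).2, fun s hs t ht hst => ?_⟩
    · have hsub := Finset.mem_powerset.1 (Finset.mem_filter.1 (e.symm j).2).1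
      have : {z | A z = (e.symm j : Finset Γ)} = ⋂ γ ∈ wordBall T n,
          {z | τ (α γ z) = z ↔ γ ∈ (e.symm j : Finset Γ)} := by
        ext z
        simp only [A, Set.mem_ofPred_eq, Set.mem_iInter, Finset.ext_iff, Finset.mem_filter]
        refine forall_congr' fun γ => ⟨fun h hγ => by rw [← h]; simp [hγ], fun h => ?_⟩
        exact ⟨fun h' => (h h'.1).1 h'.2, fun h' => ⟨hsub h', (h (hsub h')).2 h'⟩⟩
      rw [this]
      refine isClopen_biInter_finset fun γ hγ => ?_
      by_cases hj : γ ∈ (e.symm j : Finset Γ)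
      · simpa [hj] using hclopen γ hγ
      · simp only [hj, iff_false]
        exact (hclopen γ hγ).compl
    · have := hdisj s t hst
      rwa [(show A s = _ from hs), (show A t = _ from ht)] at this
  · intro i j hij s hs t ht
    have hne : s ≠ t := by
      rintro rfl
      exact hij (e.symm.injective (Subtype.ext (hs.symm.trans ht)))
    have := hdisj s t hne
    rwa [(show A s = _ from hs), (show A t = _ from ht)] at this
  · intro x
    have hx : x ∈ tile α (A (τ x)) (τ x) := by rw [hA]; rfl
    have hmem : A (τ x) ∈ 𝓕 := by
      obtain ⟨γ, hγ, -⟩ := hx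
      exact Finset.mem_filter.2 ⟨Finset.mem_powerset.2 (Finset.filter_subset _ _), γ, hγ⟩
    refine ⟨e ⟨_, hmem⟩, τ x, ?_, ?_⟩
    · simp
    · simpa using hx
  · intro j s hs
    rw [← (show A s = _ from hs), hA]
    refine hiso s ?_
    obtain ⟨γ, hγ⟩ := (Finset.mem_filter.1 (e.symm j).2).2
    rw [← (show A s = _ from hs)] at hγ
    exact ⟨_, (Finset.mem_filter.1 hγ).2⟩

end Engine

/-! ### Carving a doubling graph into tiles -/

/-- The part of the graph at distance `k + 1` or `k + 2` from `x`. Two neighbours of which only one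
lies in the ball of radius `k + 1` belong to it. -/
def shell {V : Type*} (G : SimpleGraph V) (x : V) (k : ℕ) : Set V :=
  graphBall G x (k + 2) \ graphBall G x k

section Graph

variable {V : Type*} {G : SimpleGraph V}

lemma graphBall_mono (x : V) {m n : ℕ} (h : m ≤ n) : graphBall G x m ⊆ graphBall G x n :=
  fun _ hy => edist_le_mono hy h

lemma graphBall_subset_graphBall {x z : V} {m n : ℕ} (h : G.edist z x ≤ m) :
    graphBall G x n ⊆ graphBall G z (m + n) :=
  fun _ hy => edist_le_add h hy

lemma mem_shell_of_adj {x y y' : V} {k : ℕ} (hadj : G.Adj y y') (hy : G.edist x y ≤ (k + 1 : ℕ))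
    (hy' : ¬ G.edist x y' ≤ (k + 1 : ℕ)) : y ∈ shell G x k ∧ y' ∈ shell G x k := by
  have h1 : G.edist y y' ≤ (1 : ℕ) := by
    rw [Nat.cast_one]
    exact SimpleGraph.edist_le_one_iff_adj_or_eq.2 (Or.inl hadj)
  refine ⟨⟨edist_le_mono hy (by omega), fun h => hy' ?_⟩, ?_, fun h => hy' ?_⟩
  · exact edist_le_add h h1
  · exact edist_le_mono (edist_le_add hy h1) le_rfl
  · exact edist_le_mono h (by omega)

/-- Pigeonhole: among the `s` disjoint shells between the radii `2 s` and `4 s` one has at most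
`1 / s` of the points of the large ball. -/
lemma exists_mul_sub_le {f : ℕ → ℕ} (hf : Monotone f) {s : ℕ} (hs : 0 < s) :
    ∃ k, 2 * s ≤ k ∧ k + 2 ≤ 4 * s ∧ s * (f (k + 2) - f k) ≤ f (4 * s) := by
  by_contra! h
  have hsum : ∑ j ∈ Finset.range s, (f (2 * s + 2 * (j + 1)) - f (2 * s + 2 * j)) ≤ f (4 * s) := by
    rw [Finset.sum_range_tsub (f := fun j => f (2 * s + 2 * j)) fun a b hab => hf (by omega)]
    refine (Nat.sub_le _ _).trans (hf (by omega))
  have hlt : ∑ _j ∈ Finset.range s, f (4 * s) <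
      ∑ j ∈ Finset.range s, s * (f (2 * s + 2 * (j + 1)) - f (2 * s + 2 * j)) := by
    refine Finset.sum_lt_sum_of_nonempty (by simpa using hs.ne') fun j hj => ?_
    have := Finset.mem_range.1 hj
    exact h (2 * s + 2 * j) (by omega) (by omega)
  rw [← Finset.mul_sum, Finset.sum_const, Finset.card_range, smul_eq_mul] at hlt
  exact absurd (Nat.mul_le_mul_left s hsum) (not_le.2 hlt)

/-- The shells around the points of a separated set are few altogether: each is small compared with
the ball of radius `s` around its centre, and these balls are disjoint. -/
lemma mul_ncard_biUnion_shell_le (hfin : ∀ x n, (graphBall G x n).Finite) {D s N : ℕ}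
    (hD : ∀ x, (graphBall G x (4 * s)).ncard ≤ D * (graphBall G x s).ncard) {k : V → ℕ}
    (hk : ∀ x, s * (shell G x (k x)).ncard ≤ (graphBall G x (4 * s)).ncard) {A : Finset V}
    (hA : ∀ x ∈ A, ∀ y ∈ A, G.edist x y ≤ (2 * s : ℕ) → x = y) {z : V}
    (hz : ∀ x ∈ A, G.edist z x ≤ N) :
    s * (⋃ x ∈ A, shell G x (k x)).ncard ≤ D * (graphBall G z (N + s)).ncard := by
  classical
  have hdisj : (A : Set V).PairwiseDisjoint fun x => (hfin x s).toFinset := by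
    intro x hx y hy hxy
    simp only [Function.onFun, Finset.disjoint_left, Set.Finite.mem_toFinset]
    intro w hwx hwy
    refine hxy (hA x hx y hy ?_)
    rw [two_mul]
    exact edist_le_add hwx (edist_le_symm hwy)
  calc s * (⋃ x ∈ A, shell G x (k x)).ncard
      ≤ s * ∑ x ∈ A, (shell G x (k x)).ncard :=
        Nat.mul_le_mul_left _ (Finset.set_ncard_biUnion_le _ _)
    _ ≤ ∑ x ∈ A, D * (graphBall G x s).ncard := by
        rw [Finset.mul_sum]
        exact Finset.sum_le_sum fun x _ => (hk x).trans (hD x)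
    _ = D * (A.biUnion fun x => (hfin x s).toFinset).card := by
        rw [← Finset.mul_sum, Finset.card_biUnion hdisj]
        exact congrArg _ (Finset.sum_congr rfl fun x _ => Set.ncard_eq_toFinset_card _ _)
    _ ≤ D * (graphBall G z (N + s)).ncard := by
        refine Nat.mul_le_mul_left _ ?_
        rw [Set.ncard_eq_toFinset_card _ (hfin z (N + s))]
        refine Finset.card_le_card fun y hy => ?_
        simp only [Finset.mem_biUnion, Set.Finite.mem_toFinset] at hy ⊢
        obtain ⟨x, hx, hy⟩ := hy
        exact graphBall_subset_graphBall (hz x hx) hy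

end Graph

section Engine

variable {Γ : Type*} [Group Γ] {T : Finset Γ} {α : Γ →* (Cantor ≃ₜ Cantor)}
  {M : ℕ} {κ : Cantor → ℕ}

lemma IsCode.mono {G : SimpleGraph Cantor} {M M' : ℕ} (hκ : IsCode G M κ) (h : M' ≤ M) :
    IsCode G M' κ :=
  ⟨hκ.continuous, fun x y hxy => hκ.injective x y (edist_le_mono hxy h)⟩

/-- A thin shell between the radii `2 s` and `4 s` can be chosen continuously: its position depends
only on the sizes of finitely many balls. -/
lemma IsCode.exists_continuous_radius (hT : ∀ σ ∈ T, σ⁻¹ ∈ T)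
    (hκ : IsCode (toGraph (actionGraph T α)) M κ) {s : ℕ} (hs : 0 < s) (hM : 4 * s + 4 * s ≤ M) :
    ∃ k : Cantor → ℕ, Continuous k ∧ ∀ x, 2 * s ≤ k x ∧ k x + 2 ≤ 4 * s ∧
      s * (shell (toGraph (actionGraph T α)) x (k x)).ncard ≤
        (graphBall (toGraph (actionGraph T α)) x (4 * s)).ncard := by
  classical
  set G := toGraph (actionGraph T α)
  have hex : ∀ x, ∃ k, 2 * s ≤ k ∧ k + 2 ≤ 4 * s ∧
      s * ((graphBall G x (k + 2)).ncard - (graphBall G x k).ncard) ≤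
        (graphBall G x (4 * s)).ncard := fun x =>
    exists_mul_sub_le (f := fun n => (graphBall G x n).ncard)
      (fun m n hmn => Set.ncard_le_ncard (graphBall_mono x hmn) (finite_graphBall hT x n)) hs
  refine ⟨fun x => Nat.find (hex x), ?_, fun x => ?_⟩
  · rw [continuous_iff_continuousAt]
    intro x
    have h : ∀ᶠ y in 𝓝 x, ∀ i ∈ Finset.range (4 * s + 1),
        (graphBall G y i).ncard = (graphBall G x i).ncard := by
      rw [Filter.eventually_all_finset]
      intro i hi
      have := Finset.mem_range.1 hi
      exact hκ.eventually_ncard_graphBall_eq hT (by omega) x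
    have heq : (fun _ => Nat.find (hex x)) =ᶠ[𝓝 x] fun y => Nat.find (hex y) := by
      filter_upwards [h] with y hy
      have hy' : ∀ i ≤ 4 * s, (graphBall G y i).ncard = (graphBall G x i).ncard :=
        fun i hi => hy i (Finset.mem_range.2 (by omega))
      refine Nat.find_congr' fun {k} => ?_
      refine and_congr_right fun _ => and_congr_right fun hk => ?_
      rw [hy' _ hk, hy' k (by omega), hy' _ le_rfl]
    exact continuousAt_const.congr heq
  · obtain ⟨h1, h2, h3⟩ := Nat.find_spec (hex x)
    refine ⟨h1, h2, ?_⟩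
    rwa [shell, Set.ncard_sdiff (graphBall_mono x (by omega)) (finite_graphBall hT x _)]

/-- If the balls of a proper action satisfy `|B_{16 r}| ≤ D |B_r|` for arbitrarily large `r`, then
the action is almost finite. The condition is used at two scales `s` and `Q`: the cells of the
carving at scale `s` are grouped around the points of a net at scale `Q`. -/
theorem isAlmostFiniteAction_of_doubling_frequently (hT : ∀ σ ∈ T, σ⁻¹ ∈ T)
    (hproper : IsProper (actionGraph T α)) {D : ℕ}
    (hD : ∀ r₀ : ℕ, ∃ r ≥ r₀, ∀ x, (graphBall (toGraph (actionGraph T α)) x (16 * r)).ncard ≤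
      D * (graphBall (toGraph (actionGraph T α)) x r).ncard) :
    IsAlmostFiniteAction T α := by
  intro ε hε
  set G := toGraph (actionGraph T α)
  have hfin : ∀ x n, (graphBall G x n).Finite := finite_graphBall hT
  -- The boundary will be at most the fraction `D ^ 2 / s` of each tile.
  obtain ⟨s, hs, hDs⟩ := hD (⌈(D * D : ℕ) / ε⌉₊ + 1)
  obtain ⟨Q, hQ, hDQ⟩ := hD (9 * s + 1)
  -- All distances that occur below are at most `100 * Q`.
  obtain ⟨κ, hκ⟩ := hproper.exists_isCode (100 * Q)
  obtain ⟨X, hX, hXsep, hXcov⟩ := (hκ.mono (show 2 * s ≤ _ by omega)).exists_clopen_net hT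
  obtain ⟨Z, hZ, hZsep, hZcov⟩ := (hκ.mono (show 4 * Q ≤ _ by omega)).exists_clopen_net hT
  obtain ⟨k, hkc, hk⟩ := hκ.exists_continuous_radius hT (show 0 < s by omega) (by omega)
  -- The carving: each point goes to the first point of the net whose ball contains it.
  obtain ⟨f, hfc, hf⟩ := hκ.exists_continuous_selection hT (n := 4 * s) (by omega)
    (P := fun y x => x ∈ X ∧ G.edist y x ≤ (k x + 1 : ℕ))
    (fun γ hγ => (hX.preimage (α γ).continuous).inter (by
      have : {y | G.edist y (α γ y) ≤ (k (α γ y) + 1 : ℕ)} =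
          ⋃ i ∈ Finset.range (4 * s), ({y | k (α γ y) = i} ∩
            {y | G.edist y (α γ y) ≤ (i + 1 : ℕ)}) := by
        ext y
        have := (hk (α γ y)).2.1
        simp only [Set.mem_ofPred_eq, Set.mem_iUnion, Finset.mem_range, Set.mem_inter_iff,
          exists_prop]
        exact ⟨fun h => ⟨_, by omega, rfl, h⟩, by rintro ⟨i, -, rfl, h⟩; exact h⟩
      change IsClopen {y | G.edist y (α γ y) ≤ (k (α γ y) + 1 : ℕ)}
      rw [this]
      refine isClopen_biUnion_finset fun i hi => ?_
      have := Finset.mem_range.1 hi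
      exact (isClopen_setOf_of_continuous (hkc.comp (α γ).continuous) (· = i)).inter
        (hκ.isClopen_edist_le hT continuous_id (α γ).continuous (edist_apply_le hT hγ)
          (by omega))))
    (fun y => by
      obtain ⟨x, hx, hyx⟩ := hXcov y
      have := hk x
      exact ⟨x, edist_le_mono hyx (by omega), hx, edist_le_mono hyx (by omega)⟩)
  -- A point at distance at most `2 Q` from the large net goes to the point of the net there, which
  -- is unique; so the ball of radius `Q` around a point of the net is contained in its tile.
  obtain ⟨g, hgc, hg⟩ := hκ.exists_continuous_selection hT (n := 4 * Q) (by omega)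
    (P := fun y x => x ∈ Z ∧ ((∃ z ∈ Z, G.edist y z ≤ (2 * Q : ℕ)) → G.edist y x ≤ (2 * Q : ℕ)))
    (fun γ hγ => (hZ.preimage (α γ).continuous).inter (by
      change IsClopen {y | (∃ z ∈ Z, G.edist y z ≤ (2 * Q : ℕ)) → G.edist y (α γ y) ≤ (2 * Q : ℕ)}
      simp only [imp_iff_not_or]
      exact (isClopen_exists_edist_le hT hZ _).compl.union
        (hκ.isClopen_edist_le hT continuous_id (α γ).continuous (edist_apply_le hT hγ)
          (by omega))))
    (fun y => by
      by_cases h : ∃ z ∈ Z, G.edist y z ≤ (2 * Q : ℕ)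
      · obtain ⟨z, hz, hyz⟩ := h
        exact ⟨z, edist_le_mono hyz (by omega), hz, fun _ => hyz⟩
      · obtain ⟨z, hz, hyz⟩ := hZcov y
        exact ⟨z, hyz, hz, fun h' => absurd h' h⟩)
  have hτ : ∀ y, G.edist y (g (f y)) ≤ (4 * s + 4 * Q : ℕ) := fun y =>
    edist_le_add (hf y).1 (hg (f y)).1
  refine exists_castle_of_fibers hT hproper (hgc.comp hfc) hτ ?_
  rintro z ⟨y₀, hy₀⟩
  simp only [Function.comp_apply] at hy₀ ⊢
  have hzZ : z ∈ Z := hy₀ ▸ (hg (f y₀)).2.1.1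
  set H : Set Cantor := {y | g (f y) = z} with hH
  have hHball : H ⊆ graphBall G z (4 * s + 4 * Q) := by
    intro y hy
    rw [← show g (f y) = z from hy]
    exact edist_le_symm (hτ y)
  have hHfin : H.Finite := (hfin _ _).subset hHball
  have hballH : graphBall G z Q ⊆ H := by
    intro y hy
    have h1 : G.edist (f y) z ≤ (2 * Q : ℕ) :=
      edist_le_mono (edist_le_add (edist_le_symm (hf y).1) (edist_le_symm hy)) (by omega)
    have h2 := (hg (f y)).2.1.2 ⟨z, hzZ, h1⟩
    exact hZsep _ (hg (f y)).2.1.1 _ hzZ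
      (edist_le_mono (edist_le_add (edist_le_symm h2) h1) (by omega))
  have hAfin : (X ∩ graphBall G z (4 * Q + 8 * s + 1)).Finite := (hfin _ _).inter_of_right _
  -- The boundary points of the fibre lie in shells of points of the small net: neighbours in
  -- different cells are separated by the ball of the centre that comes first.
  have hbd : boundary G H ⊆ ⋃ x ∈ hAfin.toFinset, shell G x (k x) := by
    rintro y ⟨hy, y', hy', hadj⟩
    have hne : f y ≠ f y' := fun h => hy' (by rw [hH, Set.mem_ofPred_eq, ← h]; exact hy)
    have h1 : G.edist y y' ≤ (1 : ℕ) := by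
      rw [Nat.cast_one]
      exact SimpleGraph.edist_le_one_iff_adj_or_eq.2 (Or.inl hadj)
    have hyf' : G.edist y (f y') ≤ (1 + 4 * s : ℕ) := edist_le_add h1 (hf y').1
    suffices h : ∃ x ∈ X, y ∈ shell G x (k x) ∧ G.edist y x ≤ (1 + 4 * s : ℕ) by
      obtain ⟨x, hx, hyx, hd⟩ := h
      simp only [Set.mem_iUnion, Set.Finite.mem_toFinset]
      refine ⟨x, ⟨hx, ?_⟩, hyx⟩
      exact edist_le_mono (edist_le_add (hHball hy) hd) (by omega)
    by_cases hlt : κ (f y) < κ (f y')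
    · have hout : ¬ G.edist y' (f y) ≤ (k (f y) + 1 : ℕ) := fun h => by
        have := (hk (f y)).2.1
        exact absurd ((hf y').2.2 _ (edist_le_mono h (by omega)) ⟨(hf y).2.1.1, h⟩)
          (not_le.2 hlt)
      exact ⟨f y, (hf y).2.1.1, (mem_shell_of_adj hadj (edist_le_symm (hf y).2.1.2)
        fun h => hout (edist_le_symm h)).1, edist_le_mono (hf y).1 (by omega)⟩
    · have hlt' : κ (f y') < κ (f y) := by
        refine lt_of_le_of_ne (not_lt.1 hlt) fun h => hne (hκ.injective _ _ ?_ h.symm)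
        exact edist_le_mono (edist_le_add (edist_le_symm (hf y).1) hyf') (by omega)
      have hout : ¬ G.edist y (f y') ≤ (k (f y') + 1 : ℕ) := fun h => by
        have := (hk (f y')).2.1
        exact absurd ((hf y).2.2 _ (edist_le_mono h (by omega)) ⟨(hf y').2.1.1, h⟩)
          (not_le.2 hlt')
      exact ⟨f y', (hf y').2.1.1, (mem_shell_of_adj hadj.symm (edist_le_symm (hf y').2.1.2)
        fun h => hout (edist_le_symm h)).2, hyf'⟩
  have hbdfin : (⋃ x ∈ hAfin.toFinset, shell G x (k x)).Finite :=
    Set.Finite.biUnion (Finset.finite_toSet _) fun x _ => (hfin x _).subset Set.sdiff_subset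
  have hcount : s * (boundary G H).ncard ≤ D * D * H.ncard :=
    calc s * (boundary G H).ncard
        ≤ s * (⋃ x ∈ hAfin.toFinset, shell G x (k x)).ncard :=
          Nat.mul_le_mul_left _ (Set.ncard_le_ncard hbd hbdfin)
      _ ≤ D * (graphBall G z (4 * Q + 8 * s + 1 + s)).ncard := by
          refine mul_ncard_biUnion_shell_le hfin (fun x => ?_) (fun x => (hk x).2.2) ?_ ?_
          · exact (Set.ncard_le_ncard (graphBall_mono x (by omega)) (hfin x _)).trans (hDs x)
          · intro x hx y hy hxy
            exact hXsep x (hAfin.mem_toFinset.1 hx).1 y (hAfin.mem_toFinset.1 hy).1 hxy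
          · exact fun x hx => (hAfin.mem_toFinset.1 hx).2
      _ ≤ D * (D * (graphBall G z Q).ncard) := Nat.mul_le_mul_left _
          ((Set.ncard_le_ncard (graphBall_mono z (by omega)) (hfin z _)).trans (hDQ z))
      _ ≤ D * (D * H.ncard) := Nat.mul_le_mul_left _ (Nat.mul_le_mul_left _
          (Set.ncard_le_ncard hballH hHfin))
      _ = D * D * H.ncard := (mul_assoc _ _ _).symm
  have hHpos : 0 < H.ncard := (Set.ncard_pos hHfin).2 ⟨y₀, hy₀⟩
  have hs' : ((D * D : ℕ) : ℝ) ≤ s * ε := by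
    rw [← div_le_iff₀ hε]
    exact (Nat.le_ceil _).trans (by exact_mod_cast (by omega : ⌈(D * D : ℕ) / ε⌉₊ ≤ s))
  have hspos : (0 : ℝ) < s := by exact_mod_cast (by omega : 0 < s)
  rw [isoperimetricConstant, div_le_iff₀ (by exact_mod_cast hHpos)]
  refine le_of_mul_le_mul_left ?_ hspos
  calc (s : ℝ) * (boundary G H).ncard ≤ (D * D : ℕ) * H.ncard := by exact_mod_cast hcount
    _ ≤ s * ε * H.ncard := by gcongr
    _ = s * (ε * H.ncard) := mul_assoc _ _ _

end Engine

/-! ### Polynomial growth of virtually nilpotent groups -/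

section Growth

variable {Γ : Type*} [Group Γ]

lemma one_mem_wordBall (T : Finset Γ) (n : ℕ) : (1 : Γ) ∈ wordBall T n := by
  classical
  exact Finset.one_mem_pow (Finset.mem_insert_self _ _)

lemma mem_wordBall_one {T : Finset Γ} {γ : Γ} (h : γ ∈ T) : γ ∈ wordBall T 1 :=
  mem_wordBall_succ.2 ⟨γ, Or.inr h, 1, one_mem_wordBall T 0, mul_one γ⟩

lemma mul_mem_wordBall {T : Finset Γ} {m n : ℕ} {γ δ : Γ} (hγ : γ ∈ wordBall T m)
    (hδ : δ ∈ wordBall T n) : γ * δ ∈ wordBall T (m + n) := by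
  classical
  rw [wordBall, pow_add]
  exact Finset.mul_mem_mul hγ hδ

lemma wordBall_mono {T T' : Finset Γ} (hT : T ⊆ T') {m n : ℕ} (h : m ≤ n) :
    wordBall T m ⊆ wordBall T' n := by
  classical
  exact (Finset.pow_subset_pow_left (Finset.insert_subset_insert _ hT)).trans
    (Finset.pow_subset_pow_right (Finset.mem_insert_self _ _) h)

/-- Every finite subset of `H` generates with polynomial growth. Neither the constant nor the
degree is required to be uniform, so that `H` need not be finitely generated. -/
def HasPolynomialGrowth (H : Subgroup Γ) : Prop :=
  ∀ A : Finset Γ, (A : Set Γ) ⊆ H → ∃ C d : ℕ, ∀ n, (wordBall A n).card ≤ C * (n + 1) ^ d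

/-- In a nilpotent group, the conjugates of `b` by the powers of `a` have polynomial length: with
`b' = a b a⁻¹ b⁻¹`, one step lower in the central series, the conjugate of `b` by `a ^ (p + 1)` is
the product of the conjugates of `b'` and `b` by `a ^ p`. -/
lemma exists_conj_pow_mem_wordBall {K : ℕ → Subgroup Γ} (hK : Subgroup.IsDescendingCentralSeries K)
    {c : ℕ} (hc : K c = ⊥) {H : Subgroup Γ} [H.Normal] (a : Γ) (q : ℕ) :
    ∀ i, i + q = c → ∀ b ∈ H, b ∈ K i → ∃ B : Finset Γ, (B : Set Γ) ⊆ H ∧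
      ∀ p : ℕ, a ^ p * b * (a ^ p)⁻¹ ∈ wordBall B ((p + 1) ^ q) := by
  classical
  induction q with
  | zero =>
    rintro i rfl b - hb
    rw [Nat.add_zero] at hc
    rw [hc, Subgroup.mem_bot] at hb
    subst hb
    exact ⟨∅, by simp, fun p => by simpa using one_mem_wordBall _ _⟩
  | succ q ih =>
    intro i hi b hbH hb
    have hconj : a * b * a⁻¹ * b⁻¹ ∈ K (i + 1) := by
      have := inv_mem (hK.2 b i hb a)
      simpa [commutatorElement_def, mul_assoc] using this
    obtain ⟨B, hBH, hB⟩ := ih (i + 1) (by omega) (a * b * a⁻¹ * b⁻¹)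
      (mul_mem (Subgroup.Normal.conj_mem ‹_› b hbH a) (inv_mem hbH)) hconj
    refine ⟨insert b B, ?_, fun p => ?_⟩
    · rw [Finset.coe_insert]
      exact Set.insert_subset hbH hBH
    · induction p with
      | zero => simpa using mem_wordBall_one (Finset.mem_insert_self b B)
      | succ p ihp =>
        have h1 := wordBall_mono (Finset.subset_insert b B) le_rfl (hB p)
        have h2 := mul_mem_wordBall h1 ihp
        have hle : (p + 1) ^ q + (p + 1) ^ (q + 1) ≤ (p + 1 + 1) ^ (q + 1) := by
          calc (p + 1) ^ q + (p + 1) ^ (q + 1) = (p + 1) ^ q * (p + 1 + 1) := by ring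
            _ ≤ (p + 1 + 1) ^ q * (p + 1 + 1) := by gcongr; omega
            _ = _ := (pow_succ _ _).symm
        convert wordBall_mono subset_rfl hle h2 using 1
        rw [pow_succ]
        group

lemma exists_conj_zpow_mem_wordBall {K : ℕ → Subgroup Γ} (hK : Subgroup.IsDescendingCentralSeries K)
    {c : ℕ} (hc : K c = ⊥) {H : Subgroup Γ} [H.Normal] (a : Γ) (A : Finset Γ)
    (hA : (A : Set Γ) ⊆ H) : ∃ B : Finset Γ, (B : Set Γ) ⊆ H ∧
      ∀ b ∈ A, ∀ e : ℤ, a ^ e * b * (a ^ e)⁻¹ ∈ wordBall B ((e.natAbs + 1) ^ c) := by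
  classical
  have key : ∀ b ∈ H, ∃ B : Finset Γ, (B : Set Γ) ⊆ H ∧
      ∀ e : ℤ, a ^ e * b * (a ^ e)⁻¹ ∈ wordBall B ((e.natAbs + 1) ^ c) := by
    intro b hb
    have hb0 : b ∈ K 0 := by rw [hK.1]; trivial
    obtain ⟨B₁, hB₁H, hB₁⟩ := exists_conj_pow_mem_wordBall hK hc a c 0 (by omega) b hb hb0
    obtain ⟨B₂, hB₂H, hB₂⟩ := exists_conj_pow_mem_wordBall hK hc a⁻¹ c 0 (by omega) b hb hb0
    refine ⟨B₁ ∪ B₂, by rw [Finset.coe_union]; exact Set.union_subset hB₁H hB₂H, fun e => ?_⟩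
    rcases Int.natAbs_eq e with he | he
    · have := wordBall_mono (Finset.subset_union_left (s₂ := B₂)) le_rfl (hB₁ e.natAbs)
      rwa [← zpow_natCast, ← he] at this
    · have := wordBall_mono (Finset.subset_union_right (s₁ := B₁)) le_rfl (hB₂ e.natAbs)
      rwa [inv_pow, ← zpow_natCast, ← zpow_neg, ← he] at this
  choose! B hBH hB using key
  refine ⟨A.biUnion B, ?_, fun b hb e => ?_⟩
  · rw [Finset.coe_biUnion]
    exact Set.iUnion₂_subset fun b hb => hBH b (hA hb)
  · exact wordBall_mono (Finset.subset_biUnion_of_mem B hb) le_rfl (hB b (hA hb) e)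

/-- Polynomial growth passes from a normal subgroup `H` of a nilpotent group to `H ⟨a⟩`: in a word
all powers of `a` can be moved to the right, conjugating the letters from `H`. -/
lemma HasPolynomialGrowth.sup_zpowers {K : ℕ → Subgroup Γ}
    (hK : Subgroup.IsDescendingCentralSeries K) {c : ℕ} (hc : K c = ⊥) {H : Subgroup Γ} [H.Normal]
    (hH : HasPolynomialGrowth H) (a : Γ) : HasPolynomialGrowth (H ⊔ Subgroup.zpowers a) := by
  classical
  intro A hA
  have hdec : ∀ x ∈ A, ∃ h ∈ H, ∃ e : ℤ, x = h * a ^ e := by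
    intro x hx
    obtain ⟨h, hh, g, ⟨e, rfl⟩, rfl⟩ := Subgroup.mem_sup_of_normal_left.1 (hA hx)
    exact ⟨h, hh, e, rfl⟩
  choose! h hh e he using hdec
  obtain ⟨B, hBH, hB⟩ := exists_conj_zpow_mem_wordBall hK hc a (A.image h) (by
    rw [Finset.coe_image]
    rintro _ ⟨x, hx, rfl⟩
    exact hh x hx)
  obtain ⟨C, d, hC⟩ := hH B hBH
  set E := A.sup fun x => (e x).natAbs
  have hE : ∀ x ∈ A, (e x).natAbs ≤ E := fun x hx => Finset.le_sup (f := fun x => (e x).natAbs) hx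
  have key : ∀ n j, j ≤ n → ∀ γ ∈ wordBall A j, ∃ w ∈ wordBall B (j * (n * E + 1) ^ c),
      ∃ i : ℤ, i.natAbs ≤ j * E ∧ γ = w * a ^ i := by
    intro n j
    induction j with
    | zero =>
      intro _ γ hγ
      exact ⟨1, one_mem_wordBall _ _, 0, by simp, by simpa using mem_wordBall_zero.1 hγ⟩
    | succ j ih =>
      intro hj γ hγ
      have : ∃ δ ∈ wordBall A j, ∃ x, (x = 1 ∨ x ∈ A) ∧ γ = δ * x := by
        rw [wordBall, pow_succ, Finset.mem_mul] at hγ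
        obtain ⟨δ, hδ, x, hx, rfl⟩ := hγ
        exact ⟨δ, hδ, x, Finset.mem_insert.1 hx, rfl⟩
      obtain ⟨δ, hδ, x, hx, rfl⟩ := this
      obtain ⟨w, hw, i, hi, rfl⟩ := ih (by omega) δ hδ
      rcases hx with rfl | hx
      · exact ⟨w, wordBall_mono subset_rfl (by gcongr; omega) hw, i,
          hi.trans (by gcongr; omega), by simp⟩
      · refine ⟨w * (a ^ i * h x * (a ^ i)⁻¹), ?_, i + e x, ?_, ?_⟩
        · have h1 := hB (h x) (Finset.mem_image_of_mem h hx) i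
          have hle : (i.natAbs + 1) ^ c ≤ (n * E + 1) ^ c := by
            gcongr
            exact hi.trans (by gcongr; omega)
          have := mul_mem_wordBall hw (wordBall_mono subset_rfl hle h1)
          rwa [← Nat.succ_mul] at this
        · calc (i + e x).natAbs ≤ i.natAbs + (e x).natAbs := Int.natAbs_add_le _ _
            _ ≤ j * E + E := add_le_add hi (hE x hx)
            _ = (j + 1) * E := by ring
        · conv_lhs => rw [he x hx]
          rw [zpow_add]
          group
  refine ⟨(2 * E + 1) * C * (E + 1) ^ (c * d), 1 + (c + 1) * d, fun n => ?_⟩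
  have hsub : wordBall A n ⊆ Finset.image₂ (fun w (i : ℤ) => w * a ^ i)
      (wordBall B (n * (n * E + 1) ^ c)) (Finset.Icc (-(n * E : ℕ) : ℤ) (n * E : ℕ)) := by
    intro γ hγ
    obtain ⟨w, hw, i, hi, rfl⟩ := key n n le_rfl γ hγ
    exact Finset.mem_image₂_of_mem hw (Finset.mem_Icc.2 (by omega))
  have hIcc : (Finset.Icc (-(n * E : ℕ) : ℤ) (n * E : ℕ)).card = 2 * (n * E) + 1 := by
    rw [Int.card_Icc]
    omega
  have h1 : n * E + 1 ≤ (E + 1) * (n + 1) := by nlinarith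
  have h2 : 2 * (n * E) + 1 ≤ (2 * E + 1) * (n + 1) := by nlinarith
  have h3 : n * (n * E + 1) ^ c + 1 ≤ (n + 1) * ((E + 1) * (n + 1)) ^ c := by
    have : (n * E + 1) ^ c ≤ ((E + 1) * (n + 1)) ^ c := by gcongr
    have h' : 1 ≤ ((E + 1) * (n + 1)) ^ c := Nat.one_le_pow _ _ (by positivity)
    nlinarith
  calc (wordBall A n).card
      ≤ (wordBall B (n * (n * E + 1) ^ c)).card * (2 * (n * E) + 1) := by
        rw [← hIcc]
        exact (Finset.card_le_card hsub).trans (Finset.card_image₂_le _ _ _)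
    _ ≤ C * ((n + 1) * ((E + 1) * (n + 1)) ^ c) ^ d * ((2 * E + 1) * (n + 1)) := by
        gcongr
        exact (hC _).trans (by gcongr)
    _ = (2 * E + 1) * C * (E + 1) ^ (c * d) * (n + 1) ^ (1 + (c + 1) * d) := by
        rw [mul_pow (n + 1), ← pow_mul ((E + 1) * (n + 1)), mul_pow (E + 1)]
        ring

/-- Nilpotent groups have polynomial growth: ascend the central series from the trivial subgroup,
adjoining one element at a time to obtain a given finite subset of the next term. -/
theorem hasPolynomialGrowth_of_isNilpotent [Group.IsNilpotent Γ] :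
    HasPolynomialGrowth (⊤ : Subgroup Γ) := by
  classical
  obtain ⟨c, hc⟩ := Subgroup.nilpotent_iff_lowerCentralSeries.1 ‹Group.IsNilpotent Γ›
  set K := (⊤ : Subgroup Γ).lowerCentralSeries
  have hK : Subgroup.IsDescendingCentralSeries K :=
    Subgroup.lowerCentralSeries_isDescendingCentralSeries
  have hnormal : ∀ i, ∀ N : Subgroup Γ, K (i + 1) ≤ N → N ≤ K i → N.Normal := by
    intro i N h1 h2
    refine ⟨fun b hb g => ?_⟩
    have := mul_mem (h1 (inv_mem (hK.2 b i (h2 hb) g))) hb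
    simpa [commutatorElement_def, mul_assoc] using this
  have key : ∀ q i, i + q = c → HasPolynomialGrowth (K i) := by
    intro q
    induction q with
    | zero =>
      rintro i rfl A hA
      rw [Nat.add_zero] at hc
      refine ⟨1, 0, fun n => ?_⟩
      have : ∀ γ ∈ wordBall A n, γ = 1 := by
        induction n with
        | zero => exact fun γ => mem_wordBall_zero.1
        | succ n ih =>
          intro γ hγ
          obtain ⟨σ, hσ, δ, hδ, rfl⟩ := mem_wordBall_succ.1 hγ
          rw [ih δ hδ, mul_one]
          rcases hσ with hσ | hσ
          · exact hσ
          · have := hA hσ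
            rwa [hc] at this
      simpa using Finset.card_le_one.2 fun x hx y hy => (this x hx).trans (this y hy).symm
    | succ q ih =>
      intro i hi A hA
      have hle : K (i + 1) ≤ K i := Subgroup.lowerCentralSeries_antitone _ i.le_succ
      have hN : ∀ Y : Finset Γ, (Y : Set Γ) ⊆ K i →
          HasPolynomialGrowth (K (i + 1) ⊔ Subgroup.closure (Y : Set Γ)) := by
        intro Y
        induction Y using Finset.induction_on with
        | empty =>
          intro _
          simpa using ih (i + 1) (by omega)
        | insert a Y _ ihY =>
          intro hY
          rw [Finset.coe_insert] at hY ⊢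
          have hYi := (Set.subset_insert a (Y : Set Γ)).trans hY
          have := hnormal i (K (i + 1) ⊔ Subgroup.closure (Y : Set Γ)) le_sup_left
            (sup_le hle ((Subgroup.closure_le _).2 hYi))
          have h := (ihY hYi).sup_zpowers hK hc a
          rwa [sup_assoc, Subgroup.zpowers_eq_closure, ← Subgroup.closure_union,
            Set.union_singleton] at h
      exact hN A hA A (Subgroup.subset_closure.trans (SetLike.coe_subset_coe.2 le_sup_right))
  rw [← hK.1]
  exact key c 0 (by omega)

/-- Polynomial growth passes to overgroups of finite index: in a word, coset representatives can be
moved to the left, one letter at a time. -/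
theorem exists_card_wordBall_le (hΓ : Group.IsVirtuallyNilpotent Γ) (T : Finset Γ) :
    ∃ C d : ℕ, ∀ n, (wordBall T n).card ≤ C * (n + 1) ^ d := by
  classical
  obtain ⟨H, hH, hfin⟩ := hΓ
  have : Fintype (Γ ⧸ H) := Fintype.ofFinite _
  let u : Γ → Γ ⧸ H → H := fun σ q => ⟨(σ • q).out⁻¹ * (σ * q.out), by
    rw [← QuotientGroup.eq, QuotientGroup.out_eq', ← smul_eq_mul, ← MulAction.Quotient.smul_coe,
      QuotientGroup.out_eq']⟩
  let A : Finset H := Finset.image₂ u (insert 1 T) Finset.univ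
  obtain ⟨C, d, hC⟩ := hasPolynomialGrowth_of_isNilpotent A (Set.subset_univ _)
  have key : ∀ n, ∀ γ ∈ wordBall T n, ∀ q : Γ ⧸ H, ∃ q' : Γ ⧸ H, ∃ h ∈ wordBall A n,
      γ * q.out = q'.out * (h : Γ) := by
    intro n
    induction n with
    | zero =>
      intro γ hγ q
      rw [mem_wordBall_zero.1 hγ]
      exact ⟨q, 1, one_mem_wordBall _ _, by simp⟩
    | succ n ih =>
      intro γ hγ q
      obtain ⟨σ, hσ, δ, hδ, rfl⟩ := mem_wordBall_succ.1 hγ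
      obtain ⟨q', h, hh, heq⟩ := ih δ hδ q
      refine ⟨σ • q', u σ q' * h, mem_wordBall_succ.2 ⟨u σ q', Or.inr ?_, h, hh, rfl⟩, ?_⟩
      · exact Finset.mem_image₂_of_mem (Finset.mem_insert.2 hσ) (Finset.mem_univ _)
      · rw [mul_assoc, heq]
        simp [u, mul_assoc]
  refine ⟨Fintype.card (Γ ⧸ H) * C, d, fun n => ?_⟩
  have hsub : wordBall T n ⊆ Finset.image₂
      (fun (q : Γ ⧸ H) (h : H) => q.out * (h : Γ) * (((1 : Γ) : Γ ⧸ H).out)⁻¹)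
      Finset.univ (wordBall A n) := by
    intro γ hγ
    obtain ⟨q, h, hh, heq⟩ := key n γ hγ ((1 : Γ) : Γ ⧸ H)
    exact Finset.mem_image₂.2 ⟨q, Finset.mem_univ _, h, hh, by rw [← heq]; group⟩
  calc (wordBall T n).card ≤ (Finset.univ : Finset (Γ ⧸ H)).card * (wordBall A n).card :=
        (Finset.card_le_card hsub).trans (Finset.card_image₂_le _ _ _)
    _ ≤ Fintype.card (Γ ⧸ H) * (C * (n + 1) ^ d) := by
        rw [Finset.card_univ]
        exact Nat.mul_le_mul_left _ (hC n)
    _ = _ := (mul_assoc _ _ _).symm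

/-- A function of polynomial growth is doubling at arbitrarily large scales: otherwise it would
grow by a factor over `2 * 16 ^ d` each time the scale is multiplied by `16`. -/
lemma exists_frequently_le_mul_of_polynomial {f : ℕ → ℕ} (hpos : ∀ n, 0 < f n) {C d : ℕ}
    (hf : ∀ n, f n ≤ C * (n + 1) ^ d) :
    ∀ r₀, ∃ r ≥ r₀, f (16 * r) ≤ 2 * 16 ^ d * f r := by
  intro r₀
  by_contra! h
  set r₁ := r₀ + 1
  have hgrow : ∀ k, (2 * 16 ^ d) ^ k ≤ f (16 ^ k * r₁) := by
    intro k
    induction k with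
    | zero => simpa using Nat.succ_le_of_lt (hpos r₁)
    | succ k ih =>
      have hle : r₀ ≤ 16 ^ k * r₁ := by
        calc r₀ ≤ r₁ := Nat.le_succ _
          _ ≤ 16 ^ k * r₁ := Nat.le_mul_of_pos_left _ (by positivity)
      have := (h _ hle).le
      rw [← mul_assoc, ← pow_succ'] at this
      refine le_trans ?_ this
      rw [pow_succ']
      gcongr
  have hbound : ∀ k, 2 ^ k ≤ C * (r₁ + 1) ^ d := by
    intro k
    have hpow : 16 ^ k * r₁ + 1 ≤ 16 ^ k * (r₁ + 1) := by
      have : 1 ≤ 16 ^ k := Nat.one_le_pow _ _ (by norm_num)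
      nlinarith
    have h1 : 2 ^ k * (16 ^ d) ^ k ≤ C * (r₁ + 1) ^ d * (16 ^ d) ^ k :=
      calc 2 ^ k * (16 ^ d) ^ k = (2 * 16 ^ d) ^ k := (mul_pow _ _ _).symm
        _ ≤ C * (16 ^ k * r₁ + 1) ^ d := (hgrow k).trans (hf _)
        _ ≤ C * (16 ^ k * (r₁ + 1)) ^ d := by gcongr
        _ = C * (r₁ + 1) ^ d * (16 ^ d) ^ k := by
          rw [mul_pow, ← pow_mul, ← pow_mul, mul_comm k d]
          ring
    exact Nat.le_of_mul_le_mul_right h1 (by positivity)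
  exact absurd (hbound _) (not_le.2 Nat.lt_two_pow_self)

end Growth

/-! ### Free actions of virtually nilpotent groups -/

section FreeAction

variable {Γ : Type*} [Group Γ] {T : Finset Γ} {α : Γ →* (Cantor ≃ₜ Cantor)}

/-- A nontrivial element of a free action moves every point, by compactness in one of the first
`s` coordinates, and only finitely many elements matter for a given distance. -/
lemma IsFreeAction.isProper (hT : ∀ σ ∈ T, σ⁻¹ ∈ T) (hα : IsFreeAction α) :
    IsProper (actionGraph T α) := by
  classical
  intro r _
  let U : ℕ → Set Cantor := fun s =>
    ⋂ γ ∈ (wordBall T r).erase 1, ⋃ i ∈ Finset.range s, {x | x i ≠ α γ x i}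
  have hU : ∀ s, IsOpen (U s) := fun s => isOpen_biInter_finset fun γ _ =>
    isOpen_biUnion fun i _ => isOpen_ne_fun (continuous_apply i)
      ((continuous_apply i).comp (α γ).continuous)
  have hmono : Monotone U := fun s t hst => Set.iInter₂_mono fun γ _ =>
    Set.biUnion_subset_biUnion_left fun i hi => Finset.mem_range.2
      ((Finset.mem_range.1 hi).trans_le hst)
  have hcov : (Set.univ : Set Cantor) ⊆ ⋃ s, U s := by
    intro x _
    have hne : ∀ γ ∈ (wordBall T r).erase 1, ∃ i, x i ≠ α γ x i := by
      intro γ hγ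
      by_contra! h
      exact (Finset.mem_erase.1 hγ).1 (hα γ x (funext h).symm)
    choose! i hi using hne
    refine Set.mem_iUnion.2 ⟨((wordBall T r).erase 1).sup i + 1, ?_⟩
    refine Set.mem_iInter₂.2 fun γ hγ => Set.mem_iUnion₂.2 ⟨i γ, ?_, hi γ hγ⟩
    exact Finset.mem_range.2 (Nat.lt_succ_of_le (Finset.le_sup hγ))
  obtain ⟨s, hs⟩ := isCompact_univ.elim_directed_cover U hU hcov hmono.directed_le
  refine ⟨s + 2, by omega, fun x y hxy hd => ?_⟩
  obtain ⟨γ, hγ, rfl⟩ := (edist_le_iff_exists_wordBall hT).1 hd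
  have hγ1 : γ ≠ 1 := by
    rintro rfl
    exact hxy (by simp)
  obtain ⟨i, hi, hne⟩ := Set.mem_iUnion₂.1
    (Set.mem_iInter₂.1 (hs (Set.mem_univ x)) γ (Finset.mem_erase.2 ⟨hγ1, hγ⟩))
  exact ⟨i, (Finset.mem_range.1 hi).trans_le (by omega), hne⟩

lemma IsFreeAction.ncard_graphBall (hT : ∀ σ ∈ T, σ⁻¹ ∈ T) (hα : IsFreeAction α) (x : Cantor)
    (n : ℕ) : (graphBall (toGraph (actionGraph T α)) x n).ncard = (wordBall T n).card := by
  have hinj : Function.Injective fun γ => α γ x := by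
    intro γ δ h
    have : α (δ⁻¹ * γ) x = x := by
      rw [map_mul, Homeomorph.mul_apply, show α γ x = α δ x from h, ← Homeomorph.mul_apply,
        ← map_mul]
      simp
    exact (inv_mul_eq_one.1 (hα _ x this)).symm
  rw [graphBall_eq_image hT, Set.ncard_image_of_injective _ hinj, Set.ncard_coe_finset]

theorem IsFreeAction.isAlmostFiniteAction (hT : ∀ σ ∈ T, σ⁻¹ ∈ T)
    (hΓ : Group.IsVirtuallyNilpotent Γ) (hα : IsFreeAction α) : IsAlmostFiniteAction T α := by
  obtain ⟨C, d, hC⟩ := exists_card_wordBall_le hΓ T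
  refine isAlmostFiniteAction_of_doubling_frequently hT (hα.isProper hT) (D := 2 * 16 ^ d)
    fun r₀ => ?_
  obtain ⟨r, hr, h⟩ := exists_frequently_le_mul_of_polynomial
    (fun n => Finset.card_pos.2 ⟨1, one_mem_wordBall T n⟩) hC r₀
  refine ⟨r, hr, fun x => ?_⟩
  rwa [hα.ncard_graphBall hT, hα.ncard_graphBall hT]

end FreeAction

/-! ### Cantor graphs as graphs of actions -/

section Realization

variable {E : Set (Cantor × Cantor)} {κ : Cantor → ℕ}

/-- The neighbours `x`, `y` in `E` have the colours `a`, `b`, in some order. -/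
def ColouredEdge (E : Set (Cantor × Cantor)) (κ : Cantor → ℕ) (a b : ℕ) (x y : Cantor) : Prop :=
  (x, y) ∈ E ∧ ((κ x = a ∧ κ y = b) ∨ (κ x = b ∧ κ y = a))

open Classical in
/-- The map that exchanges the endpoints of the edges with the colours `a`, `b`, and fixes the
points on no such edge. -/
noncomputable def swapMap (E : Set (Cantor × Cantor)) (κ : Cantor → ℕ) (a b : ℕ) (x : Cantor) :
    Cantor :=
  if h : ∃ y, ColouredEdge E κ a b x y then h.choose else x

lemma edist_toGraph_le_one {x y : Cantor} (h : (x, y) ∈ E) :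
    (toGraph E).edist x y ≤ (1 : ℕ) := by
  rw [Nat.cast_one, SimpleGraph.edist_le_one_iff_adj_or_eq]
  by_cases hxy : x = y
  · exact Or.inr hxy
  · exact Or.inl ((SimpleGraph.fromRel_adj _ _ _).2 ⟨hxy, Or.inl h⟩)

lemma IsCode.swapMap_eq (hκ : IsCode (toGraph E) 2 κ) {a b : ℕ} {x y : Cantor}
    (h : ColouredEdge E κ a b x y) : swapMap E κ a b x = y := by
  have hex : ∃ y, ColouredEdge E κ a b x y := ⟨y, h⟩
  rw [swapMap, dif_pos hex]
  obtain ⟨hE, hc⟩ := hex.choose_spec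
  obtain ⟨hE', hc'⟩ := h
  refine hκ.injective _ _ (edist_le_add (edist_le_symm (edist_toGraph_le_one hE))
    (edist_toGraph_le_one hE')) (by omega)

lemma swapMap_of_not {a b : ℕ} {x : Cantor} (h : ¬ ∃ y, ColouredEdge E κ a b x y) :
    swapMap E κ a b x = x :=
  dif_neg h

lemma ColouredEdge.symm (hsymm : ∀ x y, (x, y) ∈ E → (y, x) ∈ E) {a b : ℕ} {x y : Cantor}
    (h : ColouredEdge E κ a b x y) : ColouredEdge E κ a b y x :=
  ⟨hsymm _ _ h.1, h.2.symm.imp And.symm And.symm⟩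

lemma IsCode.involutive_swapMap (hκ : IsCode (toGraph E) 2 κ)
    (hsymm : ∀ x y, (x, y) ∈ E → (y, x) ∈ E) (a b : ℕ) :
    Function.Involutive (swapMap E κ a b) := by
  intro x
  by_cases h : ∃ y, ColouredEdge E κ a b x y
  · obtain ⟨y, hy⟩ := h
    rw [hκ.swapMap_eq hy, hκ.swapMap_eq (hy.symm hsymm)]
  · rw [swapMap_of_not h, swapMap_of_not h]

/-- Near a point on an edge with the given colours the exchange is continuous as the neighbourhoods
vary continuously, and the other points form an open set because `E` is closed. -/
lemma IsCode.continuous_swapMap (hκ : IsCode (toGraph E) 2 κ) (hE : IsClosed E)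
    (hcont : HasContinuousNeighborhoods E) (a b : ℕ) : Continuous (swapMap E κ a b) := by
  rw [continuous_iff_continuousAt]
  intro x
  have hloc : ∀ z : Cantor, {w | κ w = κ z} ∈ 𝓝 z := fun z =>
    (isClopen_setOf_of_continuous hκ.continuous (· = κ z)).isOpen.mem_nhds rfl
  by_cases h : ∃ y, ColouredEdge E κ a b x y
  · obtain ⟨y, hy⟩ := h
    rw [ContinuousAt, hκ.swapMap_eq hy]
    intro V hV
    change ∀ᶠ x' in 𝓝 x, swapMap E κ a b x' ∈ V
    filter_upwards [hcont x y hy.1 _ (Filter.inter_mem hV (hloc y)), hloc x] with x' hx' hκx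
    obtain ⟨y', ⟨hy'V, hκy⟩, hE'⟩ := hx'
    have : ColouredEdge E κ a b x' y' := by
      refine ⟨hE', ?_⟩
      rw [show κ x' = κ x from hκx, show κ y' = κ y from hκy]
      exact hy.2
    rw [hκ.swapMap_eq this]
    exact hy'V
  · have hclosed : IsClosed {x | ∃ y, ColouredEdge E κ a b x y} := by
      have hclopen := isClopen_setOf_of_continuous
        ((hκ.continuous.comp continuous_fst).prodMk (hκ.continuous.comp continuous_snd))
        fun p => (p.1 = a ∧ p.2 = b) ∨ (p.1 = b ∧ p.2 = a)
      convert ((hE.inter hclopen.isClosed).isCompact.image continuous_fst).isClosed using 1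
      ext x
      constructor
      · rintro ⟨y, hy⟩
        exact ⟨(x, y), hy, rfl⟩
      · rintro ⟨⟨x, y⟩, hy, rfl⟩
        exact ⟨y, hy⟩
    have heq : id =ᶠ[𝓝 x] swapMap E κ a b := by
      filter_upwards [hclosed.isOpen_compl.mem_nhds h] with x' hx'
      exact (swapMap_of_not hx').symm
    exact continuousAt_id.congr heq

/-- A proper Cantor graph with continuously varying neighbourhoods is the graph of an action of
a free group of finite rank: the generators exchange the endpoints of the edges with given
colours. -/
theorem IsCantorGraph.exists_action (hE : IsCantorGraph E) (hcont : HasContinuousNeighborhoods E)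
    (hproper : IsProper E) :
    ∃ (Γ : Type) (_ : Group Γ) (T : Finset Γ) (α : Γ →* (Cantor ≃ₜ Cantor)),
      IsSymmGenerating T ∧ actionGraph T α = E := by
  classical
  obtain ⟨κ, hκ⟩ := hproper.exists_isCode 2
  obtain ⟨k, hk⟩ := (isCompact_range hκ.continuous).bddAbove
  have hκk : ∀ x, κ x < k + 1 := fun x => Nat.lt_succ_of_le (hk ⟨x, rfl⟩)
  let ι := Fin (k + 1) × Fin (k + 1)
  let σ : ι → (Cantor ≃ₜ Cantor) := fun p =>
    { toEquiv := (hκ.involutive_swapMap hE.symm p.1 p.2).toPerm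
      continuous_toFun := hκ.continuous_swapMap hE.isClosed hcont p.1 p.2
      continuous_invFun := hκ.continuous_swapMap hE.isClosed hcont p.1 p.2 }
  let α : FreeGroup ι →* (Cantor ≃ₜ Cantor) := FreeGroup.lift σ
  let T : Finset (FreeGroup ι) :=
    Finset.univ.image FreeGroup.of ∪ Finset.univ.image fun p => (FreeGroup.of p)⁻¹
  have hof : ∀ p x, α (FreeGroup.of p) x = swapMap E κ p.1 p.2 x := by
    intro p x
    simp only [α, FreeGroup.lift_apply_of]
    rfl
  have hinv : ∀ p x, α (FreeGroup.of p)⁻¹ x = swapMap E κ p.1 p.2 x := by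
    intro p x
    conv_lhs => rw [← hκ.involutive_swapMap hE.symm p.1 p.2 x]
    rw [← hof, ← Homeomorph.mul_apply, ← map_mul, inv_mul_cancel, map_one, Homeomorph.one_apply]
  have hmove : ∀ {x y}, (x, y) ∈ E → ∃ p, α (FreeGroup.of p) x = y := by
    intro x y hxy
    refine ⟨(⟨κ x, hκk x⟩, ⟨κ y, hκk y⟩), ?_⟩
    rw [hof]
    exact hκ.swapMap_eq ⟨hxy, Or.inl ⟨rfl, rfl⟩⟩
  have hback : ∀ {a b x y}, x ≠ y → swapMap E κ a b x = y → (x, y) ∈ E := by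
    intro a b x y hne h
    by_cases hex : ∃ z, ColouredEdge E κ a b x z
    · obtain ⟨z, hz⟩ := hex
      rw [hκ.swapMap_eq hz] at h
      exact h ▸ hz.1
    · rw [swapMap_of_not hex] at h
      exact absurd h hne
  refine ⟨FreeGroup ι, inferInstance, T, α, ⟨?_, ?_⟩, ?_⟩
  · intro γ hγ
    simp only [T, Finset.mem_union, Finset.mem_image, Finset.mem_univ, true_and] at hγ ⊢
    rcases hγ with ⟨p, rfl⟩ | ⟨p, rfl⟩
    · exact Or.inr ⟨p, rfl⟩
    · exact Or.inl ⟨p, (inv_inv _).symm⟩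
  · rw [eq_top_iff, ← FreeGroup.closure_range_of]
    refine Subgroup.closure_mono ?_
    rintro _ ⟨p, rfl⟩
    exact Finset.mem_union_left _ (Finset.mem_image_of_mem _ (Finset.mem_univ p))
  · ext ⟨x, y⟩
    constructor
    · rintro (⟨hne, γ, hγ, h⟩ | ⟨h, hfix⟩)
      · simp only [T, Finset.mem_union, Finset.mem_image, Finset.mem_univ, true_and] at hγ
        rcases hγ with ⟨p, rfl⟩ | ⟨p, rfl⟩
        · exact hback hne ((hof p x).symm.trans h)
        · exact hback hne ((hinv p x).symm.trans h)
      · obtain rfl : x = y := h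
        obtain ⟨z, hz⟩ := hE.serial x
        obtain ⟨p, hp⟩ := hmove hz
        rwa [← hp, show α (FreeGroup.of p) x = x from hfix _] at hz
    · intro hxy
      by_cases hne : x = y
      · subst hne
        refine Or.inr ⟨rfl, fun γ => ?_⟩
        have hfix : ∀ a b, swapMap E κ a b x = x := fun a b => by
          by_contra h
          exact h (hE.singleton _ _ hxy (hback (Ne.symm h) rfl))
        induction γ using FreeGroup.induction_on with
        | C1 => simp
        | of p => exact (hof p x).trans (hfix _ _)
        | inv_of p _ => exact (hinv p x).trans (hfix _ _)
        | mul γ δ hγ hδ =>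
          change α (γ * δ) x = x
          rw [map_mul, Homeomorph.mul_apply, show α δ x = x from hδ]
          exact hγ
      · obtain ⟨p, hp⟩ := hmove hxy
        exact Or.inl ⟨hne, _,
          Finset.mem_union_left _ (Finset.mem_image_of_mem _ (Finset.mem_univ p)), hp⟩

end Realization

lemma IsDoubling.ncard_graphBall_le {V : Type*} {G : SimpleGraph V} {D : ℕ}
    (hfin : ∀ x n, (graphBall G x n).Finite) (h : IsDoubling G D) {r : ℕ} (hr : 1 ≤ r) (x : V)
    (i : ℕ) : (graphBall G x (2 ^ i * r)).ncard ≤ D ^ i * (graphBall G x r).ncard := by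
  induction i with
  | zero => simp
  | succ i ih =>
    have h1 := h x (2 ^ i * r) (Nat.mul_pos (by positivity) hr)
    rw [← (hfin _ _).cast_ncard_eq, ← (hfin _ _).cast_ncard_eq] at h1
    have h2 : (graphBall G x (2 * (2 ^ i * r))).ncard ≤ D * (graphBall G x (2 ^ i * r)).ncard := by
      exact_mod_cast h1
    rw [pow_succ', pow_succ', mul_assoc, mul_assoc]
    exact h2.trans (Nat.mul_le_mul_left D ih)

theorem IsCantorGraph.isAlmostFinite {E : Set (Cantor × Cantor)} {D : ℕ} (hE : IsCantorGraph E)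
    (hcont : HasContinuousNeighborhoods E) (hproper : IsProper E)
    (hD : IsDoubling (toGraph E) D) : IsAlmostFinite E := by
  obtain ⟨Γ, _, T, α, hT, rfl⟩ := hE.exists_action hcont hproper
  refine ⟨Γ, _, T, α, hT, rfl, ?_⟩
  refine isAlmostFiniteAction_of_doubling_frequently hT.1 hproper (D := D ^ 4) fun r₀ =>
    ⟨r₀ + 1, r₀.le_succ, fun x => ?_⟩
  exact hD.ncard_graphBall_le (finite_graphBall hT.1) (Nat.succ_pos _) x 4

end CantorGraph

theorem mainTheorem1 :
    (∀ (E : Set (CantorGraph.Cantor × CantorGraph.Cantor)) (D : ℕ), 0 < D →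
      CantorGraph.IsCantorGraph E →
      CantorGraph.HasContinuousNeighborhoods E →
      CantorGraph.IsProper E →
      CantorGraph.IsDoubling (CantorGraph.toGraph E) D →
      CantorGraph.IsAlmostFinite E) ∧
    (∀ (Γ : Type*) [Group Γ] (T : Finset Γ)
      (α : Γ →* (CantorGraph.Cantor ≃ₜ CantorGraph.Cantor)),
      CantorGraph.IsSymmGenerating T →
      Group.IsVirtuallyNilpotent Γ →
      CantorGraph.IsFreeAction α →
      CantorGraph.IsAlmostFiniteAction T α) := by
  refine ⟨fun E D _ hE hcont hproper hD => hE.isAlmostFinite hcont hproper hD, ?_⟩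
  intro Γ _ T α hT hΓ hα
  exact hα.isAlmostFiniteAction hT.1 hΓ
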